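/- Let $A,B\subseteq\mathbb{R}^n$ be non-empty and closed, let $\iota_A,\iota_B$ be their indicator functions ($0$ on the set, $+\infty$ off it), and put $$L(x,y)=\tfrac12\|x-y\|^2+\iota_A(x)+\iota_B(y),\qquad F(x,y,\rho)=L(x,y)+\tfrac12\rho^2\qquad (x,y\in\mathbb{R}^n,\ \rho\in\mathbb{R}).$$ All norms are Euclidean, and $\mathcal{P}_A(z)$, $\mathcal{P}_B(z)$ denote the sets of points of $A$, $B$ nearest to $z$. For $f:\mathbb{R}^m\to\mathbb{R}\cup\{\pm\infty\}$ and a point $\bar z$ with $f(\bar z)$ finite, let $$\hat\partial f(\bar z)=\Big\{w:\ \liminf_{z\to\bar z,\,z\ne\bar z}\frac{f(z)-f(\bar z)-\langle z-\bar z,w\rangle}{\|z-\bar z\|}\ge 0\Big\}$$ and let the limiting subdifferential $\partial f(\bar z)$ be the set of all limits $w=\lim_k w^k$ with $w^k\in\hat\partial f(z^k)$, $z^k\to\bar z$, $f(z^k)\to f(\bar z)$; both sets are empty where $f$ is not finite. Put $\|\partial f(z)\|_-=\inf_{v\in\partial f(z)}\|v\|$ (with $\inf\emptyset=+\infty$).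 A proper, lower semicontinuous $f$ is a *KL function* if for each $\bar z$ with $\partial f(\bar z)\neq\emptyset$ there are $\upsilon\in(0,+\infty]$, a neighbourhood $U$ of $\bar z$ and a continuous concave $\phi:[0,\upsilon)\to[0,\infty)$ with $\phi(0)=0$, $\phi\in C^1(0,\upsilon)$, $\phi'>0$ on $(0,\upsilon)$, such that $\phi'(f(z)-f(\bar z))\,\|\partial f(z)\|_-\ge 1$ for all $z\in U$ with $f(\bar z)<f(z)<f(\bar z)+\upsilon$. Let $0<\lambda_-<\lambda_+$, $0<\mu_-<\mu_+$, $\lambda_k\in[\lambda_-,\lambda_+]$, $\mu_k\in[\mu_-,\mu_+]$ for all $k\in\mathbb{N}$, and $\zeta\in(0,1]$. Let $(x^0,y^0)\in A\times B$ and suppose that $(x^k,y^k)_{k\in\mathbb{N}}$ is generated by the inexact regularized alternating projection method (iRAPM), that is, for every $k\in\mathbb{N}$, $$x^{k+1}\in\mathcal{P}_A\Big(\tfrac{1}{\lambda_k+1}x^k+\tfrac{\lambda_k}{\lambda_k+1}y^k\Big),$$ and, with $Q^{k+1}(y)=\frac{1}{2\mu_k}\|y-y^k\|^2+L(x^{k+1},y)-L(x^{k+1},y^k)$,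 the point $y^{k+1}$ lies in $B$ and there is some $\hat y^{k+1}\in\mathcal{P}_B\big(\tfrac{1}{\mu_k+1}y^k+\tfrac{\mu_k}{\mu_k+1}x^{k+1}\big)$ with $$Q^{k+1}(y^{k+1})\le\zeta\,Q^{k+1}(\hat y^{k+1}),\qquad \|y^{k+1}-\hat y^{k+1}\|\le\sqrt{-\tfrac{1-\zeta}{\zeta}\,Q^{k+1}(y^{k+1})}.$$ **Theorem.** If $F$ is a KL function, then either $\|(x^k,y^k)\|\to\infty$, or the whole sequence $(x^k,y^k)$ converges to a point $(x^*,y^*)$ that is stationary for $L$, i.e. $0\in\partial L(x^*,y^*)$. -/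

import Mathlib

open Filter Topology

noncomputable section

namespace IRAPM

/-! ### Variational analysis of extended-real-valued functions -/

section Variational

variable {H : Type*} [NormedAddCommGroup H] [InnerProductSpace ℝ H]

/-- `f` is finite at `x`. -/
def FiniteAt (f : H → EReal) (x : H) : Prop := f x ≠ ⊤ ∧ f x ≠ ⊥

/-- The Fréchet (regular) subdifferential of `f` at `a`; it is empty where `f` is not finite. -/
def frechetSubdiff (f : H → EReal) (a : H) : Set H :=
  {w | FiniteAt f a ∧
    0 ≤ liminf
      (fun x => (f x - f a - ((inner ℝ (x - a) w : ℝ) : EReal)) / ((‖x - a‖ : ℝ) : EReal))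
      (𝓝[≠] a)}

/-- The limiting (Mordukhovich) subdifferential of `f` at `a`; it is empty where `f` is not
finite. -/
def limitingSubdiff (f : H → EReal) (a : H) : Set H :=
  {w | FiniteAt f a ∧ ∃ (u : ℕ → H) (v : ℕ → H),
    Tendsto u atTop (𝓝 a) ∧ Tendsto (fun k => f (u k)) atTop (𝓝 (f a)) ∧
    (∀ k, v k ∈ frechetSubdiff f (u k)) ∧ Tendsto v atTop (𝓝 w)}

/-- `a` is a stationary point of `f`. -/
def IsStationary (f : H → EReal) (a : H) : Prop := (0 : H) ∈ limitingSubdiff f a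

/-- The lazy slope of `f` at `a`: the infimum of the norms of the limiting subgradients
(`∞` if there are none). -/
def lazySlope (f : H → EReal) (a : H) : ENNReal := ⨅ v ∈ limitingSubdiff f a, ‖v‖ₑ

/-- `f` is proper: it never takes the value `-∞` and is not identically `+∞`. -/
def IsProper (f : H → EReal) : Prop := (∀ x, f x ≠ ⊥) ∧ ∃ x, f x ≠ ⊤

/-- `φ` is a desingularizing function on `[0, υ)`, where `υ` may be `+∞`; the values of `φ`
outside `[0, υ)` are irrelevant. -/
structure IsDesingularizing (υ : EReal) (φ : ℝ → ℝ) : Prop where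
  continuousOn : ContinuousOn φ {s : ℝ | 0 ≤ s ∧ (s : EReal) < υ}
  concaveOn : ConcaveOn ℝ {s : ℝ | 0 ≤ s ∧ (s : EReal) < υ} φ
  nonneg : ∀ s : ℝ, 0 ≤ s → (s : EReal) < υ → 0 ≤ φ s
  map_zero : φ 0 = 0
  contDiffOn : ContDiffOn ℝ 1 φ {s : ℝ | 0 < s ∧ (s : EReal) < υ}
  deriv_pos : ∀ s : ℝ, 0 < s → (s : EReal) < υ → 0 < deriv φ s

/-- The Kurdyka–Łojasiewicz inequality for `f` around `a`. -/
def HasKLProperty (f : H → EReal) (a : H) : Prop :=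
  ∃ υ : EReal, 0 < υ ∧ ∃ U ∈ 𝓝 a, ∃ φ : ℝ → ℝ, IsDesingularizing υ φ ∧
    ∀ z ∈ U, f a < f z → f z < f a + υ →
      1 ≤ ENNReal.ofReal (deriv φ (f z - f a).toReal) * lazySlope f z

/-- `f` is a KL function: it is proper, lower semicontinuous, and has the KL property at each
point of the domain of its limiting subdifferential. -/
structure IsKLFunction (f : H → EReal) : Prop where
  proper : IsProper f
  lowerSemicontinuous : LowerSemicontinuous f
  kl : ∀ a, (limitingSubdiff f a).Nonempty → HasKLProperty f a

end Variational

/-! ### The feasibility problem and the algorithm -/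

/-- `ℝⁿ` with its Euclidean norm. -/
abbrev E (n : ℕ) := EuclideanSpace ℝ (Fin n)

/-- `ℝⁿ × ℝⁿ` with its Euclidean norm. -/
abbrev E2 (n : ℕ) := WithLp 2 (E n × E n)

/-- `ℝⁿ × ℝⁿ × ℝ` with its Euclidean norm. -/
abbrev E3 (n : ℕ) := WithLp 2 (E2 n × ℝ)

variable {n : ℕ}

/-- The pair `(x, y)` as a point of the Euclidean space `ℝⁿ × ℝⁿ`. -/
def pair (x y : E n) : E2 n := WithLp.toLp 2 (x, y)

open Classical in
/-- The indicator function of `A`. -/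
def indic (A : Set (E n)) (x : E n) : EReal := if x ∈ A then 0 else ⊤

/-- The (set-valued) Euclidean projection of `x` onto `A`. -/
def proj (A : Set (E n)) (x : E n) : Set (E n) :=
  {p | p ∈ A ∧ IsMinOn (fun z => (1 / 2 : ℝ) * ‖z - x‖ ^ 2) A p}

/-- `L(x, y) = ½‖x - y‖² + ι_A(x) + ι_B(y)`. -/
def L (A B : Set (E n)) (p : E2 n) : EReal :=
  (((1 / 2 : ℝ) * ‖p.fst - p.snd‖ ^ 2 : ℝ) : EReal) + indic A p.fst + indic B p.snd

/-- The merit function `F(x, y, ρ) = L(x, y) + ½ρ²`. -/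
def F (A B : Set (E n)) (q : E3 n) : EReal :=
  L A B q.fst + (((1 / 2 : ℝ) * q.snd ^ 2 : ℝ) : EReal)

/-- `Q(y) = ‖y - y₀‖² / (2μ) + L(x, y) - L(x, y₀)`, where `y₀` is the current second iterate
and `x` the new first one. -/
def Q (A B : Set (E n)) (μ : ℝ) (x y₀ : E n) (y : E n) : EReal :=
  ((1 / (2 * μ) * ‖y - y₀‖ ^ 2 : ℝ) : EReal) + L A B (pair x y) - L A B (pair x y₀)

/-- `(x k, y k)` is generated by the inexact regularized alternating projection method with step
sizes `lam k`, `mu k` and tolerance `ζ`. In `bound` below, `Q` is finite and nonpositive at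
`y (k + 1)`, so that `toReal` and the square root have their usual meaning. -/
structure IsIRAPM (A B : Set (E n)) (lam mu : ℕ → ℝ) (ζ : ℝ) (x y : ℕ → E n) : Prop where
  x_zero : x 0 ∈ A
  y_zero : y 0 ∈ B
  lam_bounds : ∃ lo hi : ℝ, 0 < lo ∧ lo < hi ∧ ∀ k, lam k ∈ Set.Icc lo hi
  mu_bounds : ∃ lo hi : ℝ, 0 < lo ∧ lo < hi ∧ ∀ k, mu k ∈ Set.Icc lo hi
  tol_mem : ζ ∈ Set.Ioc (0 : ℝ) 1
  step_x : ∀ k, x (k + 1) ∈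
    proj A ((1 / (lam k + 1)) • x k + (lam k / (lam k + 1)) • y k)
  step_y : ∀ k, y (k + 1) ∈ B ∧
    ∃ yhat ∈ proj B ((1 / (mu k + 1)) • y k + (mu k / (mu k + 1)) • x (k + 1)),
      Q A B (mu k) (x (k + 1)) (y k) (y (k + 1))
        ≤ (ζ : EReal) * Q A B (mu k) (x (k + 1)) (y k) yhat ∧
      ‖y (k + 1) - yhat‖ ≤
        Real.sqrt (-((1 - ζ) / ζ * (Q A B (mu k) (x (k + 1)) (y k) (y (k + 1))).toReal))

end IRAPM

end

/-! The values `l k = ½‖x k - y k‖²` decrease, and the decrease controls the squared step lengths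
(`step_estimates`). Small subgradients are available only at the shadow points `(x (k + 1), yh k)`,
where `yh k` is the exact projection. There `L` may lie below `l (k + 1)`, even below the limit of
`l`, where a KL inequality for `L` says nothing. The extra variable of `F` repairs this: a suitable
small `ρ k` lifts the value into `[l (k + 1), l k]`, at the cost of `ρ k` as an additional
subgradient component (`IsIRAPM.exists_subgradient`).

The KL inequality at the lifted points and concavity of `φ` then bound the squared root-decrease of
one step by a constant times the previous root-decrease times a decrement of `φ (l k - l')`
(`tendsto_of_hasKLProperty`). By the arithmetic-geometric mean inequality the path has finite length
and stays near the cluster point, so it converges (`tendsto_of_sq_le_mul_sub`). Stationarity for `L`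
follows because the subgradients at the shadow points tend to zero. -/

namespace IRAPM

/-! ### Subgradients -/

section Subgradients

variable {H : Type*} [NormedAddCommGroup H] [InnerProductSpace ℝ H]

/-- A linear minorant with a quadratic error term is given by a Fréchet subgradient. -/
lemma mem_frechetSubdiff_of_quadratic {f : H → EReal} {a w : H} {c M : ℝ} (hc : f a = (c : EReal))
    (h : ∀ z, ((c + inner ℝ (z - a) w - M * ‖z - a‖ ^ 2 : ℝ) : EReal) ≤ f z) :
    w ∈ frechetSubdiff f a := by
  refine ⟨by simp [FiniteAt, hc], ?_⟩
  -- The filter can be trivial: for `n = 0` the space `E2 n` is a single point. The liminf is then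
  -- `⊤`.
  rcases eq_or_neBot (𝓝[≠] a) with hb | hb
  · simp [hb]
  have ht : Tendsto (fun z : H => ((-(M * ‖z - a‖) : ℝ) : EReal)) (𝓝[≠] a) (𝓝 0) := by
    have h1 : Tendsto (fun z : H => -(M * ‖z - a‖)) (𝓝[≠] a) (𝓝 (-(M * ‖a - a‖))) :=
      (Continuous.tendsto (by fun_prop) a).mono_left nhdsWithin_le_nhds
    rw [sub_self, norm_zero, mul_zero, neg_zero] at h1
    exact (continuous_coe_real_ereal.tendsto 0).comp h1
  rw [← ht.liminf_eq]
  refine liminf_le_liminf ?_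
  filter_upwards [self_mem_nhdsWithin] with z hz
  have hpos : 0 < ‖z - a‖ := norm_pos_iff.2 (sub_ne_zero.2 hz)
  rw [EReal.le_div_iff_mul_le (by exact_mod_cast hpos) (EReal.coe_ne_top _), hc, ← EReal.coe_mul]
  have hz' := h z
  induction hfz : f z with
  | bot => rw [hfz] at hz'; exact absurd hz' (not_le.2 (EReal.bot_lt_coe _))
  | top => simp
  | coe r =>
    rw [hfz] at hz'
    norm_cast at hz' ⊢
    nlinarith

lemma frechetSubdiff_subset_limitingSubdiff (f : H → EReal) (a : H) :
    frechetSubdiff f a ⊆ limitingSubdiff f a := fun w hw =>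
  ⟨hw.1, fun _ => a, fun _ => w, tendsto_const_nhds, tendsto_const_nhds, fun _ => hw,
    tendsto_const_nhds⟩

lemma lazySlope_le {f : H → EReal} {a v : H} (hv : v ∈ frechetSubdiff f a) :
    lazySlope f a ≤ ‖v‖ₑ :=
  iInf₂_le v (frechetSubdiff_subset_limitingSubdiff f a hv)

end Subgradients

/-! ### Convergence of descent sequences under the Kurdyka–Łojasiewicz inequality -/

section Descent

/-- A sequence whose step lengths are controlled, near a cluster point `a`, by the geometric mean of
the previous step length and of the decrease of a vanishing potential converges to `a`. -/
lemma tendsto_of_sq_le_mul_sub {X : Type*} [PseudoMetricSpace X] {z : ℕ → X} {a : X}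
    {s p : ℕ → ℝ} {C r : ℝ} {K : ℕ} (hC : 0 ≤ C) (hr : 0 < r)
    (hs0 : ∀ k, 0 ≤ s k) (hs : Tendsto s atTop (𝓝 0))
    (hp0 : ∀ᶠ k in atTop, 0 ≤ p k) (hp : Tendsto p atTop (𝓝 0))
    (hz : ∀ k, dist (z (k + 1)) (z k) ≤ C * s k)
    (hstep : ∀ k ≥ K, dist (z (k + 1)) a < r →
      0 ≤ p (k + 1) - p (k + 2) ∧ s (k + 1) ^ 2 ≤ C * s k * (p (k + 1) - p (k + 2)))
    (ha : MapClusterPt a atTop z) : Tendsto z atTop (𝓝 a) := by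
  rw [Metric.tendsto_atTop]
  intro ε hε
  set δ := min ε r with hδ
  have hδ0 : 0 < δ := lt_min hε hr
  -- This quantity will bound the whole path length after index `k`; `N` is chosen so that it and
  -- the distance to `a` are both below `δ / 2`.
  have hsm : Tendsto (fun k => C * (2 * s k + C * p (k + 1))) atTop (𝓝 0) := by
    simpa using ((hs.const_mul 2).add ((hp.comp (tendsto_add_atTop_nat 1)).const_mul C)).const_mul C
  obtain ⟨P, hP⟩ := eventually_atTop.1 hp0
  obtain ⟨N, hNz, hNs, hNK⟩ := ((ha.frequently (Metric.ball_mem_nhds a (half_pos hδ0))).and_eventually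
    ((hsm.eventually_lt_const (half_pos hδ0)).and (eventually_ge_atTop (max K P)))).exists
  have hK : K ≤ N := le_trans (le_max_left _ _) hNK
  have hPN : P ≤ N := le_trans (le_max_right _ _) hNK
  change dist (z N) a < δ / 2 at hNz
  have hsum : ∀ m, dist (z (N + m)) a ≤ dist (z N) a + C * ∑ j ∈ Finset.range m, s (N + j) := by
    intro m
    induction m with
    | zero => simp
    | succ m ih =>
      rw [Finset.sum_range_succ, mul_add]
      have h1 : dist (z (N + (m + 1))) (z (N + m)) ≤ C * s (N + m) := hz (N + m)
      linarith [dist_triangle (z (N + (m + 1))) (z (N + m)) a]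
  -- The last step is counted twice so that the induction absorbs the `s (N + m)` on the right of
  -- the mean inequality. The bound at `m` also keeps the next point in the ball where `hstep`
  -- applies.
  have key : ∀ m, ∑ j ∈ Finset.range (m + 1), s (N + j) + s (N + m) + C * p (N + m + 1)
      ≤ 2 * s N + C * p (N + 1) := by
    intro m
    induction m with
    | zero => simp [two_mul]
    | succ m ih =>
      have hball : dist (z (N + m + 1)) a < r := by
        have h1 := hsum (m + 1)
        have h2 : ∑ j ∈ Finset.range (m + 1), s (N + j) ≤ 2 * s N + C * p (N + 1) := by
          nlinarith [hs0 (N + m), hP (N + m + 1) (by omega)]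
        have h3 := mul_le_mul_of_nonneg_left h2 hC
        have : δ ≤ r := min_le_right _ _
        rw [← add_assoc] at h1
        linarith
      obtain ⟨h0, h1⟩ := hstep (N + m) (by omega) hball
      -- Arithmetic-geometric mean: `4ab ≤ (a + b)²`.
      have h2 : 2 * s (N + m + 1) ≤ s (N + m) + C * (p (N + m + 1) - p (N + m + 2)) := by
        have := mul_nonneg hC h0
        refine abs_le_of_sq_le_sq' ?_ (by linarith [hs0 (N + m)]) |>.2
        nlinarith [sq_nonneg (s (N + m) - C * (p (N + m + 1) - p (N + m + 2)))]
      rw [Finset.sum_range_succ, ← add_assoc]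
      linarith
  refine ⟨N, fun k hk => ?_⟩
  obtain ⟨m, rfl⟩ := Nat.exists_eq_add_of_le hk
  have h1 := hsum m
  have h2 : ∑ j ∈ Finset.range m, s (N + j) ≤ 2 * s N + C * p (N + 1) := by
    have := key m
    rw [Finset.sum_range_succ] at this
    nlinarith [hs0 (N + m), hP (N + m + 1) (by omega)]
  have h3 := mul_le_mul_of_nonneg_left h2 hC
  have : δ ≤ ε := min_le_left _ _
  linarith

/-- Concavity and monotonicity of the derivative of a desingularizing function. -/
lemma IsDesingularizing.deriv_mul_le {υ : EReal} {φ : ℝ → ℝ} (hφ : IsDesingularizing υ φ)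
    {u v t : ℝ} (hu : 0 ≤ u) (huv : u ≤ v) (hv : 0 < v) (hvt : v ≤ t) (ht : (t : EReal) < υ) :
    deriv φ t * (v - u) ≤ φ v - φ u := by
  have hlt : ∀ {x : ℝ}, x ≤ t → (x : EReal) < υ := fun hx =>
    lt_of_le_of_lt (by exact_mod_cast hx) ht
  have hopen : IsOpen {s : ℝ | 0 < s ∧ (s : EReal) < υ} :=
    (isOpen_lt continuous_const continuous_id).inter
      (isOpen_lt continuous_coe_real_ereal continuous_const)
  have hdiff : ∀ x ∈ {s : ℝ | 0 < s ∧ (s : EReal) < υ}, DifferentiableAt ℝ φ x := fun x hx =>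
    ((hφ.contDiffOn.differentiableOn one_ne_zero) x hx).differentiableAt (hopen.mem_nhds hx)
  have hvmem : v ∈ {s : ℝ | 0 < s ∧ (s : EReal) < υ} := ⟨hv, hlt hvt⟩
  have htmem : t ∈ {s : ℝ | 0 < s ∧ (s : EReal) < υ} := ⟨hv.trans_le hvt, ht⟩
  rcases huv.eq_or_lt with rfl | huv'
  · simp
  -- A chord slope is used because `u = 0` is allowed, where `φ` need not be differentiable.
  have h1 : deriv φ v ≤ slope φ u v :=
    hφ.concaveOn.deriv_le_slope ⟨hu, hlt (huv.trans hvt)⟩ ⟨hv.le, hlt hvt⟩ huv' (hdiff v hvmem)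
  have h2 : deriv φ t ≤ deriv φ v := by
    rcases hvt.eq_or_lt with rfl | hvt'
    · exact le_rfl
    · have hvD : v ∈ {s : ℝ | 0 ≤ s ∧ (s : EReal) < υ} := ⟨hv.le, hlt hvt⟩
      have htD : t ∈ {s : ℝ | 0 ≤ s ∧ (s : EReal) < υ} := ⟨hv.le.trans hvt, ht⟩
      exact (hφ.concaveOn.deriv_le_slope hvD htD hvt' (hdiff t htmem)).trans
        (hφ.concaveOn.slope_le_deriv hvD htD hvt' (hdiff v hvmem))
  rw [slope_def_field, le_div_iff₀ (sub_pos.2 huv')] at h1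
  nlinarith

variable {H : Type*} [NormedAddCommGroup H] [InnerProductSpace ℝ H]

/-- Let `ℓ` decrease along `z`, with step lengths controlled by the square root of the decrease, and
suppose that close to each `z (k + 1)` there is a point `w k` with `ℓ (k + 1) ≤ f (w k) ≤ ℓ k` that
carries a correspondingly small subgradient. Under the Kurdyka–Łojasiewicz property at a cluster
point at which `f` takes the limiting value, the sequence converges. -/
theorem tendsto_of_hasKLProperty {f : H → EReal} {a : H} (hkl : HasKLProperty f a)
    {z w g : ℕ → H} {l r : ℕ → ℝ} {l' C : ℝ} (hC : 0 ≤ C)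
    (hl : Tendsto l atTop (𝓝 l')) (hfa : f a = (l' : EReal)) (hanti : Antitone l)
    (hz : ∀ k, dist (z (k + 1)) (z k) ≤ C * √(l k - l (k + 1)))
    (hw : ∀ k, dist (w k) (z (k + 1)) ≤ C * √(l k - l (k + 1)))
    (hfw : ∀ k, f (w k) = (r k : EReal)) (hr1 : ∀ k, l (k + 1) ≤ r k) (hr2 : ∀ k, r k ≤ l k)
    (hg : ∀ k, g k ∈ frechetSubdiff f (w k)) (hgn : ∀ k, ‖g k‖ ≤ C * √(l k - l (k + 1)))
    (ha : MapClusterPt a atTop z) : Tendsto z atTop (𝓝 a) := by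
  have hge : ∀ k, l' ≤ l k := hanti.le_of_tendsto hl
  have hs : Tendsto (fun k => √(l k - l (k + 1))) atTop (𝓝 0) := by
    have := (hl.sub (hl.comp (tendsto_add_atTop_nat 1))).sqrt
    simpa using this
  have hs0 : ∀ k, 0 ≤ √(l k - l (k + 1)) := fun k => Real.sqrt_nonneg _
  -- The KL inequality needs values strictly above `l'`. If `l'` is attained, `l` is eventually
  -- constant and the zero potential suffices.
  by_cases hex : ∃ K, l K = l'
  · obtain ⟨K, hK⟩ := hex
    have hconst : ∀ k ≥ K, l k = l' := fun k hk =>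
      le_antisymm (hK ▸ hanti hk) (hge k)
    refine tendsto_of_sq_le_mul_sub (p := 0) (K := K) hC one_pos hs0 hs (by simp)
      tendsto_const_nhds hz (fun k hk _ => ?_) ha
    simp [hconst (k + 1) (by omega), hconst (k + 1 + 1) (by omega)]
  push Not at hex
  have hgt : ∀ k, l' < l k := fun k => lt_of_le_of_ne (hge k) (hex k).symm
  obtain ⟨υ, hυ, U, hU, φ, hφ, hineq⟩ := hkl
  obtain ⟨η, hη0, hη⟩ := EReal.lt_iff_exists_real_btwn.1 hυ
  have hη0' : 0 < η := by exact_mod_cast hη0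
  obtain ⟨ε, hε, hball⟩ := Metric.mem_nhds_iff.1 hU
  have hlt : ∀ᶠ k in atTop, l k < l' + η ∧ C * √(l k - l (k + 1)) < ε / 2 := by
    refine (hl.eventually_lt_const (by linarith)).and ?_
    have := hs.const_mul C
    rw [mul_zero] at this
    exact this.eventually_lt_const (half_pos hε)
  obtain ⟨K, hK⟩ := eventually_atTop.1 hlt
  have hυlt : ∀ k ≥ K, ((l k - l' : ℝ) : EReal) < υ := fun k hk =>
    lt_trans (by exact_mod_cast (by linarith [(hK k hk).1] : l k - l' < η)) hη
  refine tendsto_of_sq_le_mul_sub (p := fun k => φ (l k - l')) (K := K) hC (half_pos hε) hs0 hs ?_ ?_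
    hz (fun k hk hd => ?_) ha
  · filter_upwards [eventually_ge_atTop K] with k hk
    exact hφ.nonneg _ (sub_nonneg.2 (hge k)) (hυlt k hk)
  · have h1 : Tendsto (fun k => l k - l') atTop
        (𝓝[{s : ℝ | 0 ≤ s ∧ (s : EReal) < υ}] 0) := by
      refine tendsto_nhdsWithin_iff.2 ⟨by simpa using hl.sub_const l', ?_⟩
      filter_upwards [eventually_ge_atTop K] with k hk
      exact ⟨sub_nonneg.2 (hge k), hυlt k hk⟩
    have h2 := (hφ.continuousOn 0 ⟨le_rfl, by exact_mod_cast hυ⟩).tendsto.comp h1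
    rwa [hφ.map_zero] at h2
  · have hwU : w k ∈ U := hball (by
      rw [Metric.mem_ball]
      linarith [dist_triangle (w k) (z (k + 1)) a, hw k, (hK k hk).2])
    have hrl : r k - l' < η := by linarith [hr2 k, (hK k hk).1]
    have hrυ : ((r k - l' : ℝ) : EReal) < υ := lt_trans (by exact_mod_cast hrl) hη
    have hlr : l' < r k := (hgt _).trans_le (hr1 k)
    have hslope := hineq (w k) hwU (by rw [hfa, hfw]; exact_mod_cast hlr) (by
      rw [hfa, hfw]
      calc (r k : EReal) < ((l' + η : ℝ) : EReal) := by exact_mod_cast (by linarith : r k < l' + η)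
        _ ≤ (l' : EReal) + υ := by rw [EReal.coe_add]; gcongr)
    rw [hfw, hfa, ← EReal.coe_sub, EReal.toReal_coe] at hslope
    have hd0 : 0 < deriv φ (r k - l') := hφ.deriv_pos _ (by linarith) hrυ
    have hone : 1 ≤ deriv φ (r k - l') * (C * √(l k - l (k + 1))) := by
      have h1 : (1 : ENNReal) ≤ ENNReal.ofReal (deriv φ (r k - l') * (C * √(l k - l (k + 1)))) := by
        rw [ENNReal.ofReal_mul hd0.le]
        refine hslope.trans (mul_le_mul_right ((lazySlope_le (hg k)).trans ?_) _)
        rw [← ofReal_norm]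
        exact ENNReal.ofReal_le_ofReal (hgn k)
      simpa using h1
    -- The slope at `r k` comes from step `k`, the decrease from step `k + 1`; `l (k + 1) ≤ r k` and
    -- monotonicity of `φ'` make them compatible.
    have hconc := hφ.deriv_mul_le (u := l (k + 2) - l') (v := l (k + 1) - l') (t := r k - l')
      (sub_nonneg.2 (hge _)) (by linarith [hanti (show k + 1 ≤ k + 2 by omega)])
      (sub_pos.2 (hgt _)) (by linarith [hr1 k]) hrυ
    have hdec : 0 ≤ l (k + 1) - l (k + 2) := sub_nonneg.2 (hanti (by omega))
    have hconc' : deriv φ (r k - l') * (l (k + 1) - l (k + 2))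
        ≤ φ (l (k + 1) - l') - φ (l (k + 2) - l') := by
      calc _ = deriv φ (r k - l') * (l (k + 1) - l' - (l (k + 2) - l')) := by ring
        _ ≤ _ := hconc
    refine ⟨(mul_nonneg hd0.le hdec).trans hconc', ?_⟩
    rw [Real.sq_sqrt hdec]
    have h3 := mul_le_mul_of_nonneg_left hconc' (mul_nonneg hC (hs0 k))
    have h4 := mul_le_mul_of_nonneg_right hone hdec
    nlinarith

/-- Let `w k` stay close to `z (k + 1)` and carry small subgradients. Then a subsequential limit of
`z` at which `f` takes the limiting value is stationary. -/
lemma isStationary_of_tendsto_subseq {f : H → EReal} {a : H} {z w g : ℕ → H} {s r : ℕ → ℝ}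
    {l' C : ℝ} {ψ : ℕ → ℕ} (hψ : StrictMono ψ) (hs : Tendsto s atTop (𝓝 0))
    (hz : ∀ k, dist (z (k + 1)) (z k) ≤ C * s k) (hw : ∀ k, dist (w k) (z (k + 1)) ≤ C * s k)
    (hfw : ∀ k, f (w k) = (r k : EReal)) (hr : Tendsto r atTop (𝓝 l')) (hfa : f a = (l' : EReal))
    (hg : ∀ k, g k ∈ frechetSubdiff f (w k)) (hgn : ∀ k, ‖g k‖ ≤ C * s k)
    (ha : Tendsto (z ∘ ψ) atTop (𝓝 a)) : IsStationary f a := by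
  have hCs : Tendsto (fun k => C * s k) atTop (𝓝 0) := by simpa using hs.const_mul C
  have hψt := hψ.tendsto_atTop
  have hg0 : Tendsto g atTop (𝓝 0) := squeeze_zero_norm hgn hCs
  have hd : Tendsto (fun k => dist (z k) (w k)) atTop (𝓝 0) := by
    refine squeeze_zero (fun _ => dist_nonneg) (g := fun k => C * s k + C * s k) (fun k => ?_)
      (by simpa using hCs.add hCs)
    linarith [dist_triangle (w k) (z (k + 1)) (z k), hz k, hw k, dist_comm (z k) (w k)]
  refine ⟨by simp [FiniteAt, hfa], w ∘ ψ, g ∘ ψ, ha.congr_dist (hd.comp hψt), ?_,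
    fun k => hg _, hg0.comp hψt⟩
  simp only [Function.comp_def, hfw, hfa]
  exact (continuous_coe_real_ereal.tendsto l').comp (hr.comp hψt)

end Descent
variable {n : ℕ} {A B : Set (E n)}

/-! ### The functions `L`, `F` and `Q` on their domains -/

lemma L_pair {x y : E n} (hx : x ∈ A) (hy : y ∈ B) :
    L A B (pair x y) = ((1 / 2 * ‖x - y‖ ^ 2 : ℝ) : EReal) := by
  simp [L, pair, indic, hx, hy]

lemma L_of_mem {p : E2 n} (hx : p.fst ∈ A) (hy : p.snd ∈ B) :
    L A B p = ((1 / 2 * ‖p.fst - p.snd‖ ^ 2 : ℝ) : EReal) := L_pair hx hy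

lemma L_of_notMem {p : E2 n} (h : ¬ (p.fst ∈ A ∧ p.snd ∈ B)) : L A B p = ⊤ := by
  have hbot : ∀ (S : Set (E n)) z, indic S z ≠ ⊥ := fun S z => by
    unfold indic; split_ifs <;> simp
  rw [not_and_or] at h
  rcases h with h | h
  · have : indic A p.fst = ⊤ := if_neg h
    rw [L, this, EReal.coe_add_top, EReal.top_add_of_ne_bot (hbot _ _)]
  · have : indic B p.snd = ⊤ := if_neg h
    rw [L, this, EReal.add_top_of_ne_bot]
    rw [ne_eq, EReal.add_eq_bot_iff, not_or]
    exact ⟨EReal.coe_ne_bot _, hbot _ _⟩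

lemma F_of_mem {q : E3 n} (hx : q.fst.fst ∈ A) (hy : q.fst.snd ∈ B) :
    F A B q = ((1 / 2 * ‖q.fst.fst - q.fst.snd‖ ^ 2 + 1 / 2 * q.snd ^ 2 : ℝ) : EReal) := by
  rw [F, L_of_mem hx hy, ← EReal.coe_add]

lemma F_of_notMem {q : E3 n} (h : ¬ (q.fst.fst ∈ A ∧ q.fst.snd ∈ B)) : F A B q = ⊤ := by
  rw [F, L_of_notMem h, EReal.top_add_coe]

lemma Q_of_mem {μ : ℝ} {x y₀ y : E n} (hx : x ∈ A) (hy₀ : y₀ ∈ B) (hy : y ∈ B) :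
    Q A B μ x y₀ y
      = ((1 / (2 * μ) * ‖y - y₀‖ ^ 2 + 1 / 2 * ‖x - y‖ ^ 2 - 1 / 2 * ‖x - y₀‖ ^ 2 : ℝ) : EReal) := by
  rw [Q, L_pair hx hy, L_pair hx hy₀, ← EReal.coe_add, ← EReal.coe_sub]

/-! ### Regularized projections -/

section Projection

variable {c : ℝ} {u v p : E n}

/-- A nearest point to a weighted mean minimizes the weighted sum of squared distances. -/
lemma le_of_mem_proj (hc : 0 < c) (hp : p ∈ proj A ((1 / (c + 1)) • u + (c / (c + 1)) • v))
    {x : E n} (hx : x ∈ A) :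
    1 / (2 * c) * ‖p - u‖ ^ 2 + 1 / 2 * ‖p - v‖ ^ 2
      ≤ 1 / (2 * c) * ‖x - u‖ ^ 2 + 1 / 2 * ‖x - v‖ ^ 2 := by
  have hc1 : 0 < c + 1 := by linarith
  -- Completing the square: the weighted sum is a multiple of the squared distance to the mean, plus
  -- a term independent of `z`.
  have hid : ∀ z : E n, 1 / (2 * c) * ‖z - u‖ ^ 2 + 1 / 2 * ‖z - v‖ ^ 2
      = (c + 1) / c * (1 / 2 * ‖z - ((1 / (c + 1)) • u + (c / (c + 1)) • v)‖ ^ 2)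
        + 1 / (2 * (c + 1)) * ‖v - u‖ ^ 2 := by
    intro z
    have h1 : z - ((1 / (c + 1)) • u + (c / (c + 1)) • v)
        = (1 / (c + 1)) • (z - u) + (c / (c + 1)) • (z - v) := by
      have : z = (1 / (c + 1)) • z + (c / (c + 1)) • z := by
        rw [← add_smul, ← add_div, add_comm 1 c, div_self hc1.ne', one_smul]
      nth_rewrite 1 [this]
      module
    have h2 : v - u = (z - u) - (z - v) := by abel
    rw [h1, h2, norm_add_sq_real, norm_sub_sq_real (z - u), norm_smul, norm_smul, inner_smul_left,
      inner_smul_right, mul_pow, mul_pow, Real.norm_eq_abs, Real.norm_eq_abs, sq_abs, sq_abs]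
    simp only [conj_trivial]
    field_simp
    ring
  rw [hid p, hid x]
  have h := isMinOn_iff.1 hp.2 x hx
  gcongr ?_ + _
  exact mul_le_mul_of_nonneg_left h (by positivity)

/-- The optimality condition at a minimizer of a weighted sum of squared distances. -/
lemma inner_le_of_mem_proj (hc : 0 < c)
    (hp : p ∈ proj A ((1 / (c + 1)) • u + (c / (c + 1)) • v)) {x : E n} (hx : x ∈ A) :
    inner ℝ (x - p) (v - p + (1 / c) • (u - p)) ≤ (1 / 2 + 1 / (2 * c)) * ‖x - p‖ ^ 2 := by
  have h := le_of_mem_proj hc hp hx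
  have hu : x - u = (x - p) - (u - p) := by abel
  have hv : x - v = (x - p) - (v - p) := by abel
  rw [hu, hv, norm_sub_sq_real (x - p), norm_sub_sq_real (x - p), norm_sub_rev p u, norm_sub_rev p v] at h
  rw [inner_add_right, inner_smul_right]
  have : 1 / c = 2 * (1 / (2 * c)) := by field_simp
  rw [this]
  linarith

end Projection

/-! ### Subgradients of `L` and `F` -/

section Subgradients

variable {x y v₁ v₂ : E n} {M : ℝ}

lemma pair_mem_frechetSubdiff_L (hx : x ∈ A) (hy : y ∈ B)
    (h : ∀ x' ∈ A, ∀ y' ∈ B, 1 / 2 * ‖x - y‖ ^ 2 + inner ℝ (x' - x) v₁ + inner ℝ (y' - y) v₂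
      - M * (‖x' - x‖ ^ 2 + ‖y' - y‖ ^ 2) ≤ 1 / 2 * ‖x' - y'‖ ^ 2) :
    pair v₁ v₂ ∈ frechetSubdiff (L A B) (pair x y) := by
  refine mem_frechetSubdiff_of_quadratic (L_pair hx hy) (M := M) fun z => ?_
  by_cases hz : z.fst ∈ A ∧ z.snd ∈ B
  · rw [L_of_mem hz.1 hz.2, EReal.coe_le_coe_iff, WithLp.prod_norm_sq_eq_of_L2,
      WithLp.prod_inner_apply, ← add_assoc]
    exact h z.fst hz.1 z.snd hz.2
  · rw [L_of_notMem hz]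
    exact le_top

/-- The added term `½ρ²` is convex with derivative `ρ`, so the minorant that serves `L` also serves
`F`. -/
lemma toLp_pair_mem_frechetSubdiff_F {ρ : ℝ} (hM : 0 ≤ M) (hx : x ∈ A) (hy : y ∈ B)
    (h : ∀ x' ∈ A, ∀ y' ∈ B, 1 / 2 * ‖x - y‖ ^ 2 + inner ℝ (x' - x) v₁ + inner ℝ (y' - y) v₂
      - M * (‖x' - x‖ ^ 2 + ‖y' - y‖ ^ 2) ≤ 1 / 2 * ‖x' - y'‖ ^ 2) :
    (WithLp.toLp 2 (pair v₁ v₂, ρ) : E3 n)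
      ∈ frechetSubdiff (F A B) (WithLp.toLp 2 (pair x y, ρ)) := by
  refine mem_frechetSubdiff_of_quadratic (F_of_mem (q := WithLp.toLp 2 (pair x y, ρ)) hx hy)
    (M := M) fun z => ?_
  by_cases hz : z.fst.fst ∈ A ∧ z.fst.snd ∈ B
  · rw [F_of_mem hz.1 hz.2, EReal.coe_le_coe_iff, WithLp.prod_norm_sq_eq_of_L2,
      WithLp.prod_inner_apply]
    have h1 := h z.fst.fst hz.1 z.fst.snd hz.2
    have h2 : inner ℝ (z - WithLp.toLp 2 (pair x y, ρ)).ofLp.1 (pair v₁ v₂)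
        = inner ℝ (z.fst.fst - x) v₁ + inner ℝ (z.fst.snd - y) v₂ :=
      WithLp.prod_inner_apply _ _
    have h3 : ‖(z - WithLp.toLp 2 (pair x y, ρ)).fst‖ ^ 2
        = ‖z.fst.fst - x‖ ^ 2 + ‖z.fst.snd - y‖ ^ 2 := WithLp.prod_norm_sq_eq_of_L2 _
    have h4 : inner ℝ (z - WithLp.toLp 2 (pair x y, ρ)).ofLp.2 ρ = ρ * (z.snd - ρ) := rfl
    have h5 : ‖(z - WithLp.toLp 2 (pair x y, ρ)).snd‖ ^ 2 = (z.snd - ρ) ^ 2 := sq_abs _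
    change 1 / 2 * ‖x - y‖ ^ 2 + 1 / 2 * ρ ^ 2
      + (inner ℝ (z - WithLp.toLp 2 (pair x y, ρ)).ofLp.1 (pair v₁ v₂)
        + inner ℝ (z - WithLp.toLp 2 (pair x y, ρ)).ofLp.2 ρ) - _ ≤ _
    rw [h2, h3, h4, h5]
    nlinarith [sq_nonneg (z.snd - ρ), mul_nonneg hM (sq_nonneg (z.snd - ρ))]
  · rw [F_of_notMem hz]
    exact le_top

/-- Optimality of a pair of regularized projections, in terms of the function `L`. -/
lemma quadratic_minorant_of_mem_proj {lam mu : ℝ} (hlam : 0 < lam) (hmu : 0 < mu) {x₀ y₀ : E n}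
    (hx : x ∈ proj A ((1 / (lam + 1)) • x₀ + (lam / (lam + 1)) • y₀))
    (hy : y ∈ proj B ((1 / (mu + 1)) • y₀ + (mu / (mu + 1)) • x)) :
    ∀ x' ∈ A, ∀ y' ∈ B, 1 / 2 * ‖x - y‖ ^ 2
      + inner ℝ (x' - x) (y₀ - y + (1 / lam) • (x₀ - x)) + inner ℝ (y' - y) ((1 / mu) • (y₀ - y))
      - (1 + 1 / (2 * lam) + 1 / (2 * mu)) * (‖x' - x‖ ^ 2 + ‖y' - y‖ ^ 2)
        ≤ 1 / 2 * ‖x' - y'‖ ^ 2 := by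
  intro x' hx' y' hy'
  have h1 := inner_le_of_mem_proj hlam hx hx'
  have h2 := inner_le_of_mem_proj hmu hy hy'
  -- Convexity of the smooth part, whose gradient at `(x, y)` is `(x - y, y - x)`. The remainders of
  -- `v₁`, `v₂` are proximal normals from the two projections.
  have h3 : 1 / 2 * ‖x - y‖ ^ 2 + inner ℝ (x' - x) (x - y) + inner ℝ (y' - y) (y - x)
      ≤ 1 / 2 * ‖x' - y'‖ ^ 2 := by
    have e1 : x' - y' = (x - y) + ((x' - x) - (y' - y)) := by abel
    have e2 : inner ℝ (y' - y) (y - x) = - inner ℝ (y' - y) (x - y) := by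
      rw [← inner_neg_right, neg_sub]
    rw [e1, norm_add_sq_real, inner_sub_right (x - y), e2, real_inner_comm (x' - x),
      real_inner_comm (y' - y)]
    nlinarith [sq_nonneg ‖(x' - x) - (y' - y)‖]
  have e1 : y₀ - y + (1 / lam) • (x₀ - x) = (x - y) + (y₀ - x + (1 / lam) • (x₀ - x)) := by abel
  have e2 : (1 / mu) • (y₀ - y) = (y - x) + (x - y + (1 / mu) • (y₀ - y)) := by abel
  rw [e1, e2, inner_add_right, inner_add_right (y' - y)]
  have p1 : 0 ≤ (1 / 2 + 1 / (2 * mu)) * ‖x' - x‖ ^ 2 := by positivity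
  have p2 : 0 ≤ (1 / 2 + 1 / (2 * lam)) * ‖y' - y‖ ^ 2 := by positivity
  linarith

end Subgradients

/-! ### One step of the algorithm -/

/-- The estimates for one step, in terms of the decrease of `½‖x - y‖²`. -/
lemma step_estimates {lo hi lam mu ζ : ℝ} (hlo : 0 < lo) (hlam : lam ∈ Set.Icc lo hi)
    (hmu : mu ∈ Set.Icc lo hi) (hζ : ζ ∈ Set.Ioc (0 : ℝ) 1) {x₀ y₀ x₁ y₁ yh : E n}
    (hx₀ : x₀ ∈ A) (hy₀ : y₀ ∈ B) (hy₁ : y₁ ∈ B)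
    (hx₁ : x₁ ∈ proj A ((1 / (lam + 1)) • x₀ + (lam / (lam + 1)) • y₀))
    (hyh : yh ∈ proj B ((1 / (mu + 1)) • y₀ + (mu / (mu + 1)) • x₁))
    (hQ : Q A B mu x₁ y₀ y₁ ≤ (ζ : EReal) * Q A B mu x₁ y₀ yh)
    (hbd : ‖y₁ - yh‖ ≤ √(-((1 - ζ) / ζ * (Q A B mu x₁ y₀ y₁).toReal)))
    {κ d : ℝ} (hκ : κ = √(2 * hi) + √(1 / ζ))
    (hd : d = √(1 / 2 * ‖x₀ - y₀‖ ^ 2 - 1 / 2 * ‖x₁ - y₁‖ ^ 2)) :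
    1 / 2 * ‖x₁ - y₁‖ ^ 2 ≤ 1 / 2 * ‖x₀ - y₀‖ ^ 2 ∧
    1 / 2 * ‖x₁ - yh‖ ^ 2 ≤ 1 / 2 * ‖x₀ - y₀‖ ^ 2 ∧
    ‖x₁ - x₀‖ ≤ κ * d ∧ ‖y₁ - y₀‖ ≤ κ * d ∧ ‖y₁ - yh‖ ≤ κ * d ∧ ‖yh - y₀‖ ≤ κ * d ∧
    2 * (1 / 2 * ‖x₁ - y₁‖ ^ 2 - 1 / 2 * ‖x₁ - yh‖ ^ 2) ≤ ((2 + 1 / lo) * κ * d) ^ 2 := by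
  obtain ⟨hζ0, hζ1⟩ := hζ
  have hlam0 : 0 < lam := hlo.trans_le hlam.1
  have hmu0 : 0 < mu := hlo.trans_le hmu.1
  have hhi : 0 < hi := hmu0.trans_le hmu.2
  have hx₁A : x₁ ∈ A := hx₁.1
  rw [Q_of_mem hx₁A hy₀ hy₁, Q_of_mem hx₁A hy₀ hyh.1, ← EReal.coe_mul, EReal.coe_le_coe_iff] at hQ
  rw [Q_of_mem hx₁A hy₀ hy₁, EReal.toReal_coe] at hbd
  set q := 1 / (2 * mu) * ‖y₁ - y₀‖ ^ 2 + 1 / 2 * ‖x₁ - y₁‖ ^ 2 - 1 / 2 * ‖x₁ - y₀‖ ^ 2 with hq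
  set qh := 1 / (2 * mu) * ‖yh - y₀‖ ^ 2 + 1 / 2 * ‖x₁ - yh‖ ^ 2 - 1 / 2 * ‖x₁ - y₀‖ ^ 2 with hqh
  have hqh0 : qh ≤ 0 := by
    have := le_of_mem_proj hmu0 hyh hy₀
    rw [sub_self, norm_zero, norm_sub_rev yh x₁, norm_sub_rev y₀ x₁] at this
    rw [hqh]; linarith
  have hq0 : q ≤ 0 := hQ.trans (mul_nonpos_of_nonneg_of_nonpos hζ0.le hqh0)
  have hxdec : 1 / (2 * lam) * ‖x₁ - x₀‖ ^ 2 + 1 / 2 * ‖x₁ - y₀‖ ^ 2 ≤ 1 / 2 * ‖x₀ - y₀‖ ^ 2 := by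
    have := le_of_mem_proj hlam0 hx₁ hx₀
    rw [sub_self, norm_zero] at this
    linarith
  set D := 1 / 2 * ‖x₀ - y₀‖ ^ 2 - 1 / 2 * ‖x₁ - y₁‖ ^ 2 with hD
  have hx0 : 0 ≤ 1 / (2 * lam) * ‖x₁ - x₀‖ ^ 2 := by positivity
  have hy0 : 0 ≤ 1 / (2 * mu) * ‖y₁ - y₀‖ ^ 2 := by positivity
  have hyh0 : 0 ≤ 1 / (2 * mu) * ‖yh - y₀‖ ^ 2 := by positivity
  -- All three summands on the left are nonnegative, so each is at most `D`; in particular `-q ≤ D`.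
  have hsum : 1 / (2 * lam) * ‖x₁ - x₀‖ ^ 2 + 1 / (2 * mu) * ‖y₁ - y₀‖ ^ 2 - q ≤ D := by
    rw [hq, hD]; linarith
  have hD0 : 0 ≤ D := by linarith
  have hdn : 0 ≤ d := hd ▸ Real.sqrt_nonneg _
  have hdD : d ^ 2 = D := by rw [hd, Real.sq_sqrt hD0]
  have hsq : ∀ {c t : ℝ}, 0 < c → c ≤ hi → 1 / (2 * c) * t ^ 2 ≤ D → t ≤ √(2 * hi) * d := by
    intro c t hc hchi ht
    rw [hd, ← Real.sqrt_mul (by positivity)]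
    refine Real.le_sqrt_of_sq_le ?_
    have h1 : t ^ 2 = 2 * c * (1 / (2 * c) * t ^ 2) := by field_simp
    rw [h1]
    gcongr
  have h1 : ‖x₁ - x₀‖ ≤ √(2 * hi) * d := hsq hlam0 hlam.2 (by linarith)
  have h2 : ‖y₁ - y₀‖ ≤ √(2 * hi) * d := hsq hmu0 hmu.2 (by linarith)
  have hqD : -(1 / ζ * q) ≤ 1 / ζ * D := by
    rw [← mul_neg]
    exact mul_le_mul_of_nonneg_left (by linarith) (by positivity)
  have h3 : ‖y₁ - yh‖ ≤ √(1 / ζ) * d := by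
    rw [hd, ← Real.sqrt_mul (by positivity)]
    refine hbd.trans (Real.sqrt_le_sqrt ?_)
    have : (1 - ζ) / ζ * q = 1 / ζ * q - q := by field_simp
    rw [this]
    linarith
  have hs1 : 0 ≤ √(2 * hi) * d := by positivity
  have hs2 : 0 ≤ √(1 / ζ) * d := by positivity
  have hκd : κ * d = √(2 * hi) * d + √(1 / ζ) * d := by rw [hκ, add_mul]
  have h4 : ‖yh - y₀‖ ≤ κ * d := by
    have := norm_sub_le_norm_sub_add_norm_sub yh y₁ y₀
    rw [norm_sub_rev yh y₁] at this
    linarith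
  refine ⟨by linarith, by linarith, by linarith, by linarith, by linarith, h4, ?_⟩
  -- The relative accuracy test limits how far the exact step can undercut the inexact one, which is
  -- what keeps the lift small.
  have hqhq : -qh ≤ -(1 / ζ * q) := by
    have : q / ζ ≤ qh := by rw [div_le_iff₀ hζ0]; linarith
    rw [neg_le_neg_iff, one_div_mul_eq_div]
    exact this
  have hinv : 1 / (2 * mu) * ‖yh - y₀‖ ^ 2 ≤ 1 / (2 * lo) * (κ * d) ^ 2 := by
    have := hmu.1
    gcongr
  have hζκ : 1 / ζ * D ≤ (κ * d) ^ 2 := by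
    have h5 : 1 / ζ * D = (√(1 / ζ) * d) ^ 2 := by
      rw [mul_pow, Real.sq_sqrt (by positivity), hdD]
    rw [h5]
    exact pow_le_pow_left₀ hs2 (by linarith) 2
  have h6 : 2 * (1 / 2 * ‖x₁ - y₁‖ ^ 2 - 1 / 2 * ‖x₁ - yh‖ ^ 2) ≤ (2 + 1 / lo) * (κ * d) ^ 2 := by
    have h7 : (2 + 1 / lo) * (κ * d) ^ 2 = 2 * ((κ * d) ^ 2 + 1 / (2 * lo) * (κ * d) ^ 2) := by
      field_simp
    rw [h7]
    linarith
  refine h6.trans ?_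
  have h8 : 0 < 1 / lo := by positivity
  have h9 : 2 + 1 / lo ≤ (2 + 1 / lo) ^ 2 := le_self_pow₀ (by linarith) two_ne_zero
  rw [mul_assoc, mul_pow (2 + 1 / lo)]
  exact mul_le_mul_of_nonneg_right h9 (sq_nonneg _)

/-! ### Norms in the product spaces -/

lemma norm_pair_le (a b : E n) : ‖pair a b‖ ≤ ‖a‖ + ‖b‖ := by
  refine abs_le_of_sq_le_sq' ?_ (by positivity) |>.2
  have : ‖pair a b‖ ^ 2 = ‖a‖ ^ 2 + ‖b‖ ^ 2 := WithLp.prod_norm_sq_eq_of_L2 _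
  nlinarith [mul_nonneg (norm_nonneg a) (norm_nonneg b)]

lemma norm_toLp_le (p : E2 n) (ρ : ℝ) : ‖(WithLp.toLp 2 (p, ρ) : E3 n)‖ ≤ ‖p‖ + |ρ| := by
  refine abs_le_of_sq_le_sq' ?_ (by positivity) |>.2
  have : ‖(WithLp.toLp 2 (p, ρ) : E3 n)‖ ^ 2 = ‖p‖ ^ 2 + |ρ| ^ 2 := WithLp.prod_norm_sq_eq_of_L2 _
  nlinarith [mul_nonneg (norm_nonneg p) (abs_nonneg ρ)]

lemma dist_pair_le (a b a' b' : E n) : dist (pair a b) (pair a' b') ≤ ‖a - a'‖ + ‖b - b'‖ := by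
  rw [dist_eq_norm]
  exact norm_pair_le _ _

lemma dist_toLp_le (p p' : E2 n) (ρ ρ' : ℝ) :
    dist (WithLp.toLp 2 (p, ρ) : E3 n) (WithLp.toLp 2 (p', ρ')) ≤ dist p p' + |ρ - ρ'| := by
  rw [dist_eq_norm, dist_eq_norm]
  exact norm_toLp_le _ _

/-! ### Convergence of the algorithm -/

/-- Along the iterates, `½‖x - y‖²` decreases, and after each step there is a nearby point at which
`F` lies between two consecutive values and has a small subgradient, as does `L`. -/
theorem IsIRAPM.exists_subgradient {lam mu : ℕ → ℝ} {ζ : ℝ} {x y : ℕ → E n}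
    (halg : IsIRAPM A B lam mu ζ x y) {l : ℕ → ℝ} (hl : l = fun k => 1 / 2 * ‖x k - y k‖ ^ 2) :
    Antitone l ∧ ∃ (C : ℝ) (yh v₁ v₂ : ℕ → E n) (ρ : ℕ → ℝ), 0 ≤ C ∧ ∀ k,
      ‖x (k + 1) - x k‖ + ‖y (k + 1) - y k‖ ≤ C * √(l k - l (k + 1)) ∧
      ‖y (k + 1) - yh k‖ + |ρ k| ≤ C * √(l k - l (k + 1)) ∧
      ‖v₁ k‖ + ‖v₂ k‖ + |ρ k| ≤ C * √(l k - l (k + 1)) ∧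
      x (k + 1) ∈ A ∧ yh k ∈ B ∧
      l (k + 1) ≤ 1 / 2 * ‖x (k + 1) - yh k‖ ^ 2 + 1 / 2 * ρ k ^ 2 ∧
      1 / 2 * ‖x (k + 1) - yh k‖ ^ 2 + 1 / 2 * ρ k ^ 2 ≤ l k ∧
      pair (v₁ k) (v₂ k) ∈ frechetSubdiff (L A B) (pair (x (k + 1)) (yh k)) ∧
      (WithLp.toLp 2 (pair (v₁ k) (v₂ k), ρ k) : E3 n)
        ∈ frechetSubdiff (F A B) (WithLp.toLp 2 (pair (x (k + 1)) (yh k), ρ k)) := by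
  obtain ⟨lo₁, hi₁, hlo₁, -, hlam⟩ := halg.lam_bounds
  obtain ⟨lo₂, hi₂, hlo₂, -, hmu⟩ := halg.mu_bounds
  have hxA : ∀ k, x k ∈ A := fun k => k.casesOn halg.x_zero fun k => (halg.step_x k).1
  have hyB : ∀ k, y k ∈ B := fun k => k.casesOn halg.y_zero fun k => (halg.step_y k).1
  choose hy1 yh hyh hQ hbd using halg.step_y
  set lo := min lo₁ lo₂
  set hi := max hi₁ hi₂
  have hlo : 0 < lo := lt_min hlo₁ hlo₂
  have hlam' : ∀ k, lam k ∈ Set.Icc lo hi := fun k =>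
    ⟨(min_le_left _ _).trans (hlam k).1, (hlam k).2.trans (le_max_left _ _)⟩
  have hmu' : ∀ k, mu k ∈ Set.Icc lo hi := fun k =>
    ⟨(min_le_right _ _).trans (hmu k).1, (hmu k).2.trans (le_max_right _ _)⟩
  obtain ⟨κ, hκ⟩ : ∃ κ, κ = √(2 * hi) + √(1 / ζ) := ⟨_, rfl⟩
  have hκ0 : 0 ≤ κ := by rw [hκ]; positivity
  have hest := fun k => step_estimates hlo (hlam' k) (hmu' k) halg.tol_mem (hxA k) (hyB k) (hy1 k)
    (halg.step_x k) (hyh k) (hQ k) (hbd k) hκ rfl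
  have hlk : ∀ k, 1 / 2 * ‖x k - y k‖ ^ 2 = l k := fun k => by rw [hl]
  simp only [hlk] at hest
  have hanti : Antitone l := antitone_nat_of_succ_le fun k => (hest k).1
  -- With this choice `F` at the lifted point equals the larger of `l (k + 1)` and `½‖x (k + 1) - yh
  -- k‖²`.
  let ρ : ℕ → ℝ := fun k => √(2 * max (l (k + 1) - 1 / 2 * ‖x (k + 1) - yh k‖ ^ 2) 0)
  -- The most demanding bound, on the subgradient, needs `κ * (3 + 3 / lo)`.
  refine ⟨hanti, κ * (4 + 4 / lo), yh,
    fun k => y k - yh k + (1 / lam k) • (x k - x (k + 1)),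
    fun k => (1 / mu k) • (y k - yh k), ρ, by positivity, fun k => ?_⟩
  obtain ⟨-, e1, e2, e3, e4, e5, e6⟩ := hest k
  set d := √(l k - l (k + 1))
  have hd0 : 0 ≤ d := Real.sqrt_nonneg _
  have hκd : 0 ≤ κ * d := mul_nonneg hκ0 hd0
  have hlo' : 0 ≤ κ * d / lo := by positivity
  have hC : κ * (4 + 4 / lo) * d = 4 * (κ * d) + 4 * (κ * d / lo) := by ring
  have hρ0 : 0 ≤ ρ k := Real.sqrt_nonneg _
  have hρsq : ρ k ^ 2 = 2 * max (l (k + 1) - 1 / 2 * ‖x (k + 1) - yh k‖ ^ 2) 0 :=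
    Real.sq_sqrt (by positivity)
  have hρ : |ρ k| ≤ 2 * (κ * d) + κ * d / lo := by
    have h1 : (2 + 1 / lo) * κ * d = 2 * (κ * d) + κ * d / lo := by ring
    rw [abs_of_nonneg hρ0, ← h1]
    refine Real.sqrt_le_iff.2 ⟨by positivity, ?_⟩
    rw [mul_max_of_nonneg _ _ zero_le_two]
    exact max_le e6 (by simpa using sq_nonneg _)
  have hscale : ∀ {c : ℝ} {v : E n}, lo ≤ c → ‖v‖ ≤ κ * d → ‖(1 / c) • v‖ ≤ κ * d / lo := by
    intro c v hc hv
    have hc0 : 0 < c := hlo.trans_le hc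
    rw [norm_smul, Real.norm_of_nonneg (by positivity), one_div_mul_eq_div]
    gcongr
  have hb1 := hscale (hlam' k).1 (norm_sub_rev (x k) (x (k + 1)) ▸ e2)
  have hb2 := hscale (hmu' k).1 (norm_sub_rev (y k) (yh k) ▸ e5)
  have hv1 := norm_add_le (y k - yh k) ((1 / lam k) • (x k - x (k + 1)))
  rw [norm_sub_rev (y k)] at hv1
  have hlam0 : 0 < lam k := hlo.trans_le (hlam' k).1
  have hmu0 : 0 < mu k := hlo.trans_le (hmu' k).1
  have hmin := quadratic_minorant_of_mem_proj hlam0 hmu0 (halg.step_x k) (hyh k)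
  have hmax1 := le_max_left (l (k + 1) - 1 / 2 * ‖x (k + 1) - yh k‖ ^ 2) 0
  have hmax2 : max (l (k + 1) - 1 / 2 * ‖x (k + 1) - yh k‖ ^ 2) 0
      ≤ l k - 1 / 2 * ‖x (k + 1) - yh k‖ ^ 2 :=
    max_le (by linarith [hanti k.le_succ]) (by linarith)
  refine ⟨by linarith, by linarith, ?_, hxA _, (hyh k).1, by linarith, by linarith,
    pair_mem_frechetSubdiff_L (hxA _) (hyh k).1 hmin,
    toLp_pair_mem_frechetSubdiff_F (by positivity) (hxA _) (hyh k).1 hmin⟩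
  change ‖y k - yh k + (1 / lam k) • (x k - x (k + 1))‖ + ‖(1 / mu k) • (y k - yh k)‖ + |ρ k| ≤ _
  linarith

end IRAPM

/-! ### From a cluster point to convergence of the whole sequence -/

theorem mainTheorem1 (n : ℕ) (A B : Set (IRAPM.E n)) (hA : IsClosed A) (hB : IsClosed B)
    (lam mu : ℕ → ℝ) (ζ : ℝ) (x y : ℕ → IRAPM.E n)
    (halg : IRAPM.IsIRAPM A B lam mu ζ x y)
    (hKL : IRAPM.IsKLFunction (IRAPM.F A B)) :
    Tendsto (fun k => ‖IRAPM.pair (x k) (y k)‖) atTop atTop ∨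
      ∃ z : IRAPM.E2 n, Tendsto (fun k => IRAPM.pair (x k) (y k)) atTop (𝓝 z) ∧
        IRAPM.IsStationary (IRAPM.L A B) z := by
  rw [or_iff_not_imp_left]
  intro hdiv
  obtain ⟨R, hR⟩ : ∃ R, ∃ᶠ k in atTop, IRAPM.pair (x k) (y k) ∈ Metric.ball (0 : IRAPM.E2 n) R := by
    rw [tendsto_atTop] at hdiv
    push Not at hdiv
    obtain ⟨R, hR⟩ := hdiv
    exact ⟨R, hR.mono fun k hk => by simpa using hk⟩
  obtain ⟨a, -, ψ, hψ, ha⟩ := tendsto_subseq_of_frequently_bounded Metric.isBounded_ball hR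
  obtain ⟨l, hl⟩ : ∃ l : ℕ → ℝ, l = fun k => 1 / 2 * ‖x k - y k‖ ^ 2 := ⟨_, rfl⟩
  obtain ⟨hanti, C, yh, v₁, v₂, ρ, hC, hstep⟩ := halg.exists_subgradient hl
  choose hz hw hg hxA hyB hr1 hr2 hL hF using hstep
  have hfst : Continuous fun p : IRAPM.E2 n => p.fst := by fun_prop
  have hsnd : Continuous fun p : IRAPM.E2 n => p.snd := by fun_prop
  have hxk : ∀ k, x k ∈ A := fun k => k.casesOn halg.x_zero hxA
  have hyk : ∀ k, y k ∈ B := fun k => k.casesOn halg.y_zero fun k => (halg.step_y k).1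
  have haA : a.fst ∈ A := hA.mem_of_tendsto ((hfst.tendsto a).comp ha) (.of_forall fun k => hxk _)
  have haB : a.snd ∈ B := hB.mem_of_tendsto ((hsnd.tendsto a).comp ha) (.of_forall fun k => hyk _)
  obtain ⟨l', hl'⟩ : ∃ l', l' = 1 / 2 * ‖a.fst - a.snd‖ ^ 2 := ⟨_, rfl⟩
  -- Monotonicity and nonnegativity give a limit; the subsequence identifies it.
  have hlim : Tendsto l atTop (𝓝 l') := by
    refine tendsto_atTop_of_antitone hanti |>.resolve_left (fun h => ?_) |>.elim fun m hm => ?_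
    · obtain ⟨k, hk⟩ := (h.eventually_lt_atBot 0).exists
      rw [hl] at hk
      exact absurd hk (not_lt.2 (by positivity))
    · have hlp : ∀ k, 1 / 2 * ‖(IRAPM.pair (x k) (y k)).fst - (IRAPM.pair (x k) (y k)).snd‖ ^ 2
          = l k := fun k => by rw [hl]; rfl
      have h1 : Tendsto (l ∘ ψ) atTop (𝓝 l') := by
        rw [hl']
        refine Tendsto.congr (fun k => hlp (ψ k)) ?_
        exact ((((hfst.tendsto a).comp ha).sub ((hsnd.tendsto a).comp ha)).norm.pow 2).const_mul _
      rwa [tendsto_nhds_unique h1 (hm.comp hψ.tendsto_atTop)]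
  have hs : Tendsto (fun k => √(l k - l (k + 1))) atTop (𝓝 0) := by
    simpa using (hlim.sub (hlim.comp (tendsto_add_atTop_nat 1))).sqrt
  have hrlim : Tendsto (fun k => 1 / 2 * ‖x (k + 1) - yh k‖ ^ 2 + 1 / 2 * ρ k ^ 2) atTop (𝓝 l') :=
    tendsto_of_tendsto_of_tendsto_of_le_of_le (hlim.comp (tendsto_add_atTop_nat 1)) hlim hr1 hr2
  have hρ0 : Tendsto ρ atTop (𝓝 0) := by
    refine squeeze_zero_norm (a := fun k => C * √(l k - l (k + 1)))
      (fun k => ?_) (by simpa using hs.const_mul C)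
    rw [Real.norm_eq_abs]
    linarith [hw k, norm_nonneg (y (k + 1) - yh k)]
  -- The iterates are placed at height `0`; only the shadow points are lifted.
  let z : ℕ → IRAPM.E3 n := fun k => WithLp.toLp 2 (IRAPM.pair (x k) (y k), 0)
  let w : ℕ → IRAPM.E3 n := fun k => WithLp.toLp 2 (IRAPM.pair (x (k + 1)) (yh k), ρ k)
  let a₀ : IRAPM.E3 n := WithLp.toLp 2 (a, 0)
  have hza : Tendsto (z ∘ ψ) atTop (𝓝 a₀) := by
    have hcont : Continuous fun p : IRAPM.E2 n => (WithLp.toLp 2 (p, 0) : IRAPM.E3 n) := by fun_prop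
    exact (hcont.tendsto a).comp ha
  have hFa : IRAPM.F A B a₀ = (l' : EReal) := by
    rw [IRAPM.F_of_mem (q := a₀) haA haB, hl']
    simp [a₀]
  have hFw : ∀ k, IRAPM.F A B (w k)
      = ((1 / 2 * ‖x (k + 1) - yh k‖ ^ 2 + 1 / 2 * ρ k ^ 2 : ℝ) : EReal) := fun k =>
    IRAPM.F_of_mem (q := w k) (hxA k) (hyB k)
  have hzz : ∀ k, dist (z (k + 1)) (z k) ≤ C * √(l k - l (k + 1)) := fun k => by
    have h1 := IRAPM.dist_toLp_le (IRAPM.pair (x (k + 1)) (y (k + 1))) (IRAPM.pair (x k) (y k)) 0 0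
    have h2 := IRAPM.dist_pair_le (x (k + 1)) (y (k + 1)) (x k) (y k)
    rw [sub_self, abs_zero] at h1
    linarith [hz k]
  have hpw : ∀ k, dist (IRAPM.pair (x (k + 1)) (yh k)) (IRAPM.pair (x (k + 1)) (y (k + 1)))
      ≤ ‖y (k + 1) - yh k‖ := fun k => by
    simpa [norm_sub_rev] using IRAPM.dist_pair_le (x (k + 1)) (yh k) (x (k + 1)) (y (k + 1))
  have hwz : ∀ k, dist (w k) (z (k + 1)) ≤ C * √(l k - l (k + 1)) := fun k => by
    have h1 := IRAPM.dist_toLp_le (IRAPM.pair (x (k + 1)) (yh k))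
      (IRAPM.pair (x (k + 1)) (y (k + 1))) (ρ k) 0
    rw [sub_zero] at h1
    linarith [hw k, hpw k]
  have hgn : ∀ k, ‖(WithLp.toLp 2 (IRAPM.pair (v₁ k) (v₂ k), ρ k) : IRAPM.E3 n)‖
      ≤ C * √(l k - l (k + 1)) := fun k => by
    linarith [hg k, IRAPM.norm_toLp_le (IRAPM.pair (v₁ k) (v₂ k)) (ρ k),
      IRAPM.norm_pair_le (v₁ k) (v₂ k)]
  -- Stationarity for `F` comes before convergence: it provides the nonempty subdifferential
  -- required by `hKL.kl`.
  have hstat : IRAPM.IsStationary (IRAPM.F A B) a₀ :=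
    IRAPM.isStationary_of_tendsto_subseq hψ hs hzz hwz hFw hrlim hFa hF hgn hza
  have hconv : Tendsto z atTop (𝓝 a₀) :=
    IRAPM.tendsto_of_hasKLProperty (hKL.kl a₀ ⟨0, hstat⟩) hC hlim hFa hanti hzz hwz hFw hr1 hr2 hF
      hgn (hza.mapClusterPt.of_comp hψ.tendsto_atTop)
  have hpair : Tendsto (fun k => IRAPM.pair (x k) (y k)) atTop (𝓝 a) := by
    have hcont : Continuous fun q : IRAPM.E3 n => q.fst := by fun_prop
    exact (hcont.tendsto a₀).comp hconv
  -- The stationarity argument is repeated for `L` without the lift; since `ρ k → 0`, the values of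
  -- `L` at the shadow points also tend to `l'`.
  refine ⟨a, hpair, IRAPM.isStationary_of_tendsto_subseq (z := fun k => IRAPM.pair (x k) (y k))
    (w := fun k => IRAPM.pair (x (k + 1)) (yh k)) (g := fun k => IRAPM.pair (v₁ k) (v₂ k))
    (r := fun k => 1 / 2 * ‖x (k + 1) - yh k‖ ^ 2) (C := C) (l' := l') strictMono_id hs
    (fun k => (IRAPM.dist_pair_le _ _ _ _).trans (hz k)) (fun k => ?_)
    (fun k => IRAPM.L_pair (hxA k) (hyB k)) ?_ (by rw [IRAPM.L_of_mem haA haB, hl']) hL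
    (fun k => ?_) hpair⟩
  · linarith [hpw k, hw k, abs_nonneg (ρ k)]
  · have h := hrlim.sub ((hρ0.pow 2).const_mul (1 / 2))
    simpa only [add_sub_cancel_right, zero_pow two_ne_zero, mul_zero, sub_zero] using h
  · linarith [hg k, abs_nonneg (ρ k), IRAPM.norm_pair_le (v₁ k) (v₂ k)]
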